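/- A numerical semigroup is a submonoid $S$ of $(\mathbb{N},+)$ with finite complement. Write $S^*=S\setminus\{0\}$, let $P(S)=S^*\setminus(S^*+S^*)$ be its set of primitive elements, $e(S)=|P(S)|$ its embedding dimension, $m(S)=\min S^*$ its multiplicity, $g(S)=|\mathbb{N}\setminus S|$ its genus, $F(S)=\max(\mathbb{Z}\setminus S)$ its Frobenius number, $c(S)=F(S)+1$ its conductor, and $L(S)=\{a\in S : a<F(S)\}$ its left part. One says that $S$ satisfies Wilf's conjecture if $e(S)\,|L(S)|\ge c(S)$. A child of $S$ is a numerical semigroup of the form $S\setminus\{a\}$ with $a\in P(S)$ and $a>F(S)$; a descendant of $S$ is a numerical semigroup obtained from $S$ by finitely many (possibly zero) successive passages to a child. Corollary. Let $G\ge 1$ be an integer and let $S$ be a numerical semigroup of genus $g(S)\le G$ such that $$e(S)\ \ge\ \frac{m(S)}{3}+(G-g(S)).$$ Then every descendant $T$ of $S$ of genus $g(T)\le G$ satisfies Wilf's conjecture. -/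

import Mathlib

/-- A numerical semigroup: a submonoid of `ℕ` with finite complement. -/
@[ext]
structure NumericalSemigroup extends AddSubmonoid ℕ where
  finite_compl' : (carrierᶜ).Finite

namespace NumericalSemigroup

instance : SetLike NumericalSemigroup ℕ where
  coe S := S.carrier
  coe_injective := by
    intro S T h
    cases S
    cases T
    congr
    exact SetLike.coe_injective h

theorem finite_compl (S : NumericalSemigroup) : ((S : Set ℕ)ᶜ).Finite := S.finite_compl'

/-- `S* = S \ {0}`. -/
def star (S : NumericalSemigroup) : Set ℕ := {a | a ∈ S ∧ a ≠ 0}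

/-- The set `P` of primitive elements: nonzero elements of `S` that are not the sum of two
nonzero elements of `S`. -/
def primitives (S : NumericalSemigroup) : Set ℕ :=
  {a | a ∈ S.star ∧ ¬ ∃ x ∈ S.star, ∃ y ∈ S.star, x + y = a}

/-- The embedding dimension `e = |P|` (`P` is finite, see `finite_primitives`). -/
noncomputable def embeddingDimension (S : NumericalSemigroup) : ℕ := S.primitives.ncard

/-- The multiplicity `m = min S*` (attained, see `isLeast_multiplicity`). -/
noncomputable def multiplicity (S : NumericalSemigroup) : ℕ := sInf S.star

/-- The genus `g = |ℕ \ S|`. -/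
noncomputable def genus (S : NumericalSemigroup) : ℕ := ((S : Set ℕ)ᶜ).ncard

/-- The set `ℤ \ S`. -/
def intGaps (S : NumericalSemigroup) : Set ℤ := {z | ¬ ∃ a ∈ S, (a : ℤ) = z}

/-- The Frobenius number `F = max (ℤ \ S)` (attained, see `isGreatest_frobenius`);
it is `-1` when `S = ℕ`. -/
noncomputable def frobenius (S : NumericalSemigroup) : ℤ := sSup S.intGaps

/-- The conductor `c = F + 1`. -/
noncomputable def conductor (S : NumericalSemigroup) : ℤ := S.frobenius + 1

/-- The left part `L = {a ∈ S | a < F}`. -/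
def leftPart (S : NumericalSemigroup) : Set ℕ := {a | a ∈ S ∧ (a : ℤ) < S.frobenius}

/-- The right part `R = {a ∈ S | a > F}`. -/
def rightPart (S : NumericalSemigroup) : Set ℕ := {a | a ∈ S ∧ S.frobenius < (a : ℤ)}

/-- `S` satisfies Wilf's conjecture: `e |L| ≥ c`. -/
def SatisfiesWilf (S : NumericalSemigroup) : Prop :=
  (S.embeddingDimension : ℤ) * (S.leftPart.ncard : ℤ) ≥ S.conductor

/-- `S'` is a child of `S`: `S' = S \ {a}` for some right primitive element `a` of `S`. -/
def IsChild (S' S : NumericalSemigroup) : Prop :=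
  ∃ a ∈ S.primitives ∩ S.rightPart, (S' : Set ℕ) = (S : Set ℕ) \ {a}

/-- `T` is a descendant of `S`: it is reached from `S` by finitely many (possibly zero) passages
to a child. -/
def IsDescendant (T S : NumericalSemigroup) : Prop :=
  Relation.ReflTransGen (fun A B : NumericalSemigroup => B.IsChild A) S T

theorem isGreatest_frobenius (S : NumericalSemigroup) : IsGreatest S.intGaps S.frobenius := by
  have hne : S.intGaps.Nonempty := ⟨-1, by rintro ⟨a, -, h⟩; omega⟩
  have hbdd : BddAbove S.intGaps := by
    obtain ⟨N, hN⟩ := S.finite_compl.bddAbove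
    refine ⟨(N : ℤ), fun z hz => ?_⟩
    by_contra hlt
    push Not at hlt
    refine hz ⟨z.toNat, ?_, by omega⟩
    by_contra hmem
    have := hN (show z.toNat ∈ (S : Set ℕ)ᶜ from hmem)
    omega
  exact ⟨Int.csSup_mem hne hbdd, fun z hz => le_csSup hbdd hz⟩

theorem mem_of_frobenius_lt (S : NumericalSemigroup) {a : ℕ} (h : S.frobenius < (a : ℤ)) :
    a ∈ S := by
  by_contra ha
  have : (a : ℤ) ∈ S.intGaps := by
    rintro ⟨b, hb, hba⟩
    exact ha (by rwa [← Int.ofNat_inj.mp hba])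
  exact absurd (S.isGreatest_frobenius.2 this) (not_le.mpr h)

theorem isLeast_multiplicity (S : NumericalSemigroup) : IsLeast S.star S.multiplicity := by
  have hne : S.star.Nonempty :=
    ⟨S.frobenius.toNat + 1, S.mem_of_frobenius_lt (by push_cast; omega), by omega⟩
  exact ⟨Nat.sInf_mem hne, fun a ha => Nat.sInf_le ha⟩

theorem finite_primitives (S : NumericalSemigroup) : S.primitives.Finite := by
  refine (Set.finite_Iic (S.frobenius.toNat + S.multiplicity)).subset fun a ha => ?_
  by_contra hlt
  simp only [Set.mem_Iic, not_le] at hlt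
  exact ha.2 ⟨S.multiplicity, S.isLeast_multiplicity.1, a - S.multiplicity,
    ⟨S.mem_of_frobenius_lt (by omega), by omega⟩, by omega⟩

theorem finite_leftPart (S : NumericalSemigroup) : S.leftPart.Finite :=
  (Set.finite_Iic S.frobenius.toNat).subset fun a ha => by
    have := ha.2
    simp only [Set.mem_Iic]
    omega

end NumericalSemigroup

/-! Along a child the genus grows by one while 3e - m falls by at most 3, so 3e + 3g - m never
decreases on descendants. The hypothesis says that this quantity is at least 3G for S. A descendant
T of genus at most G therefore has m(T) ≤ 3e(T), and everything reduces to Eliahou's theorem: m ≤ 3e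
implies Wilf's conjecture (`satisfiesWilf_of_multiplicity_le`).

For e ≥ 3, let V be the set of nonzero Apéry elements with respect to m, p = e - 1 the number of
primitive ones, D the set of decomposable ones and q = ⌈c/m⌉. Let l(w) count the elements of w + mℕ
below c. Then |L| ≥ q + ∑ l over V, and m = e + |D|. Wilf's inequality follows once the elements of
D, each costing q or q - 1, are paid for by (p + 1) ∑ l (`WeightedDownset.sum_cost_le`). The
discount for large elements accounts for qm - c.

If ∑ l ≥ 2q, this is immediate from |D| ≤ 2(p + 1). Otherwise the sums of two primitives are paid
for by the primitives alone, because each l(x) occurs p + 1 times among the unordered pairs. Longer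
sums are paid for by (p + 1) ∑ l over D, where p + 1 ≥ 3. They are scarce, since every decomposition
x + y in V uses weight at least q - 1 out of a total below 2q. The cases are a sum 2u + x with x ≠
u, a multiple 4x, and isolated triples 3x.

For e ≤ 2 the semigroup is ℕ or symmetric, and c ≤ 2|L|. -/

/-! ### Weighted downsets and their cost inequality -/

/-- A finite set `V` of positive integers, closed under partial sums of its elements, with a weight
`l` on its elements and a cost `q - 1` or `q` on its sums. It models the nonzero Apéry elements
of a numerical semigroup of depth `q`. -/
structure WeightedDownset (V : Finset ℕ) (l cost : ℕ → ℕ) (q : ℕ) : Prop where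
  pos : ∀ x ∈ V, 0 < x
  down : ∀ x ∈ V, ∀ y ∈ V, ∀ z ∈ V, x + y + z ∈ V → x + y ∈ V
  weight_lt : ∀ x ∈ V, ∀ y ∈ V, x + y ∈ V → l (x + y) < l x
  cost_le_add : ∀ x ∈ V, ∀ y ∈ V, x + y ∈ V → cost (x + y) ≤ l x + l y
  cost_le : ∀ z, cost z ≤ q
  le_cost : ∀ z, q ≤ cost z + 1

/-- The elements of `V` that are sums of two elements of `V`. -/
def decomps (V : Finset ℕ) : Finset ℕ := {z ∈ V | ∃ x ∈ V, ∃ y ∈ V, x + y = z}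

/-- The elements of `V` that are not sums of two elements of `V`. -/
def prims (V : Finset ℕ) : Finset ℕ := {z ∈ V | ¬ ∃ x ∈ V, ∃ y ∈ V, x + y = z}

theorem mem_decomps {V : Finset ℕ} {z : ℕ} :
    z ∈ decomps V ↔ z ∈ V ∧ ∃ x ∈ V, ∃ y ∈ V, x + y = z := by simp [decomps]

theorem mem_prims {V : Finset ℕ} {z : ℕ} :
    z ∈ prims V ↔ z ∈ V ∧ ¬ ∃ x ∈ V, ∃ y ∈ V, x + y = z := by simp [prims]

theorem prims_subset (V : Finset ℕ) : prims V ⊆ V := Finset.filter_subset _ _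

theorem decomps_subset (V : Finset ℕ) : decomps V ⊆ V := Finset.filter_subset _ _

theorem sum_prims_add_sum_decomps (V : Finset ℕ) (f : ℕ → ℕ) :
    ∑ x ∈ prims V, f x + ∑ x ∈ decomps V, f x = ∑ x ∈ V, f x := by
  rw [add_comm]
  exact Finset.sum_filter_add_sum_filter_not V _ f

theorem card_prims_add_card_decomps (V : Finset ℕ) :
    (prims V).card + (decomps V).card = V.card := by
  simpa using sum_prims_add_sum_decomps V (fun _ => 1)

/-- Summing `f x + f y` over the pairs `x ≤ y` counts each `f x` exactly `|Q| + 1` times. -/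
theorem sum_pairs_le (Q : Finset ℕ) (f : ℕ → ℤ) :
    ∑ p ∈ Q ×ˢ Q with p.1 ≤ p.2, (f p.1 + f p.2) = (Q.card + 1) * ∑ x ∈ Q, f x := by
  have h1 : ∑ p ∈ Q ×ˢ Q with p.1 ≤ p.2, f p.2 = ∑ p ∈ Q ×ˢ Q with p.2 ≤ p.1, f p.1 := by
    refine Finset.sum_nbij' Prod.swap Prod.swap ?_ ?_ ?_ ?_ ?_ <;>
      simp +contextual
  rw [Finset.sum_add_distrib, h1, Finset.sum_filter, Finset.sum_filter, Finset.sum_product,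
    Finset.sum_product, ← Finset.sum_add_distrib, Finset.mul_sum]
  refine Finset.sum_congr rfl fun x hx => ?_
  rw [← Finset.sum_add_distrib]
  have : ∀ y ∈ Q, ((if x ≤ y then f x else 0) + if y ≤ x then f x else 0)
      = f x + if x = y then f x else 0 := by
    intro y _
    rcases lt_trichotomy x y with h | h | h
    · simp [h.le, h.not_ge, h.ne]
    · simp [h]
    · simp [h.le, h.not_ge, h.ne']
  rw [Finset.sum_congr rfl this, Finset.sum_add_distrib, Finset.sum_ite_eq, if_pos hx]
  simp
  ring

namespace WeightedDownset

variable {V : Finset ℕ} {l cost : ℕ → ℕ} {q : ℕ}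

theorem one_le (h : WeightedDownset V l cost q) {x y : ℕ} (hx : x ∈ V) (hy : y ∈ V)
    (hxy : x + y ∈ V) : 1 ≤ l x := by
  have := h.weight_lt x hx y hy hxy
  omega

theorem prim_or (h : WeightedDownset V l cost q) {z : ℕ} (hz : z ∈ V) :
    z ∈ prims V ∨ ∃ x ∈ prims V, ∃ w ∈ V, x + w = z := by
  induction z using Nat.strong_induction_on with
  | _ z ih =>
    by_cases hp : z ∈ prims V
    · exact Or.inl hp
    right
    have : ∃ x ∈ V, ∃ y ∈ V, x + y = z := by
      by_contra hc
      exact hp (mem_prims.2 ⟨hz, hc⟩)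
    obtain ⟨x, hx, y, hy, rfl⟩ := this
    have hy0 := h.pos y hy
    rcases ih x (by omega) hx with hx' | ⟨t, ht, w, hw, rfl⟩
    · exact ⟨x, hx', y, hy, rfl⟩
    · refine ⟨t, ht, w + y, ?_, by ring⟩
      exact h.down w hw y hy t (prims_subset V ht) (by convert hz using 1; ring)

theorem not_prim_add (_h : WeightedDownset V l cost q) {x y : ℕ} (hx : x ∈ V) (hy : y ∈ V) :
    x + y ∉ prims V := fun hp => (mem_prims.1 hp).2 ⟨x, hx, y, hy, rfl⟩

/-- The sums of two primitive elements cost at most `(|prims V| + 1)` times the weight of the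
primitive elements, and less if some pairs are charged `q` instead of their total weight. -/
theorem sum_cost_pairs_le (h : WeightedDownset V l cost q) (B : Finset (ℕ × ℕ))
    (hB : B ⊆ {p ∈ prims V ×ˢ prims V | p.1 ≤ p.2}) :
    ∑ z ∈ V with ∃ x ∈ prims V, ∃ y ∈ prims V, x + y = z, (cost z : ℤ) ≤
      ((prims V).card + 1) * ∑ x ∈ prims V, (l x : ℤ)
        + ∑ p ∈ B, ((q : ℤ) - l p.1 - l p.2) := by
  classical
  set Q := prims V with hQ
  set E := {p ∈ Q ×ˢ Q | p.1 ≤ p.2} with hE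
  set w : ℕ × ℕ → ℤ := fun p => if p ∈ B then (q : ℤ) else l p.1 + l p.2 with hw
  have hw0 : ∀ p, 0 ≤ w p := by
    intro p
    simp only [hw]
    split_ifs <;> positivity
  have h1 : ∑ p ∈ E, w p = ((Q.card : ℤ) + 1) * ∑ x ∈ Q, (l x : ℤ)
      + ∑ p ∈ B, ((q : ℤ) - l p.1 - l p.2) := by
    rw [← sum_pairs_le Q (fun x => (l x : ℤ))]
    have : ∑ p ∈ B, ((q : ℤ) - l p.1 - l p.2)
        = ∑ p ∈ E, if p ∈ B then ((q : ℤ) - l p.1 - l p.2) else 0 := by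
      rw [← Finset.sum_filter]
      congr 1
      ext p
      simp only [Finset.mem_filter]
      exact ⟨fun hp => ⟨hB hp, hp⟩, fun hp => hp.2⟩
    rw [this, ← Finset.sum_add_distrib]
    refine Finset.sum_congr rfl fun p _ => ?_
    simp only [hw]
    split_ifs <;> ring
  rw [← h1]
  have h2 : ({z ∈ V | ∃ x ∈ Q, ∃ y ∈ Q, x + y = z} : Finset ℕ)
      ⊆ Finset.image (fun p => p.1 + p.2) {p ∈ E | p.1 + p.2 ∈ V} := by
    intro z hz
    obtain ⟨hz, x, hx, y, hy, rfl⟩ := Finset.mem_filter.1 hz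
    rw [Finset.mem_image]
    rcases le_total x y with hxy | hxy
    · exact ⟨(x, y), by simp [hE, hx, hy, hxy, hz], rfl⟩
    · exact ⟨(y, x), by simp [hE, hx, hy, hxy, add_comm y x, hz], add_comm y x⟩
  calc _ ≤ ∑ z ∈ Finset.image (fun p : ℕ × ℕ => p.1 + p.2) {p ∈ E | p.1 + p.2 ∈ V},
        (cost z : ℤ) := Finset.sum_le_sum_of_subset_of_nonneg h2 fun _ _ _ => by positivity
    _ ≤ ∑ p ∈ E with p.1 + p.2 ∈ V, (cost (p.1 + p.2) : ℤ) :=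
        Finset.sum_image_le_of_nonneg fun _ _ => by positivity
    _ ≤ ∑ p ∈ E with p.1 + p.2 ∈ V, w p := by
        refine Finset.sum_le_sum fun p hp => ?_
        simp only [hE, Finset.mem_filter, Finset.mem_product] at hp
        simp only [hw]
        split_ifs
        · exact_mod_cast h.cost_le _
        · exact_mod_cast h.cost_le_add _ (prims_subset V hp.1.1.1) _
            (prims_subset V hp.1.1.2) hp.2
    _ ≤ ∑ p ∈ E, w p :=
        Finset.sum_le_sum_of_subset_of_nonneg (Finset.filter_subset _ _) fun p _ _ => hw0 p

/-- It suffices to pay for the sums of more than two primitive elements with the weight of the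
decomposable elements. -/
theorem sum_cost_le_of_rest (h : WeightedDownset V l cost q) (hp : 3 ≤ (prims V).card + 1)
    (T W : Finset ℕ) (B : Finset (ℕ × ℕ)) (hB : B ⊆ {p ∈ prims V ×ˢ prims V | p.1 ≤ p.2})
    (hW : W ⊆ decomps V)
    (hT : ∀ z ∈ decomps V, (∃ x ∈ prims V, ∃ y ∈ prims V, x + y = z) ∨ z ∈ T)
    (hle : ∑ z ∈ T, (cost z : ℤ) + ∑ p ∈ B, ((q : ℤ) - l p.1 - l p.2) ≤ 3 * ∑ z ∈ W, (l z : ℤ)) :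
    ∑ z ∈ decomps V, cost z ≤ ((prims V).card + 1) * ∑ x ∈ V, l x := by
  classical
  have h1 : ∑ z ∈ decomps V, (cost z : ℤ) ≤
      ∑ z ∈ V with ∃ x ∈ prims V, ∃ y ∈ prims V, x + y = z, (cost z : ℤ)
        + ∑ z ∈ T, (cost z : ℤ) := by
    rw [← Finset.sum_union_inter]
    have hsub : decomps V ⊆
        ({z ∈ V | ∃ x ∈ prims V, ∃ y ∈ prims V, x + y = z} : Finset ℕ) ∪ T := by
      intro z hz
      rcases hT z hz with hz' | hz'
      · exact Finset.mem_union_left _ (Finset.mem_filter.2 ⟨decomps_subset V hz, hz'⟩)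
      · exact Finset.mem_union_right _ hz'
    have := Finset.sum_le_sum_of_subset_of_nonneg (f := fun z => (cost z : ℤ)) hsub
      fun _ _ _ => by positivity
    refine this.trans (le_add_of_nonneg_right (Finset.sum_nonneg fun _ _ => by positivity))
  have h2 := h.sum_cost_pairs_le B hB
  have h3 : ∑ z ∈ W, (l z : ℤ) ≤ ∑ z ∈ decomps V, (l z : ℤ) :=
    Finset.sum_le_sum_of_subset_of_nonneg hW fun _ _ _ => by positivity
  have h4 : ∑ x ∈ prims V, (l x : ℤ) + ∑ x ∈ decomps V, (l x : ℤ) = ∑ x ∈ V, (l x : ℤ) := by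
    exact_mod_cast sum_prims_add_sum_decomps V l
  -- The factor 3 in the hypothesis on `W` is available because the weight of the decomposable
  -- elements is counted |`prims V`| + 1 ≥ 3 times.
  have h5 : (3 : ℤ) ≤ (prims V).card + 1 := by exact_mod_cast hp
  have h6 : (0 : ℤ) ≤ ∑ x ∈ decomps V, (l x : ℤ) := Finset.sum_nonneg fun _ _ => by positivity
  have h7 : ((∑ z ∈ decomps V, cost z : ℕ) : ℤ) ≤
      (((prims V).card + 1 : ℕ) : ℤ) * ((∑ x ∈ V, l x : ℕ) : ℤ) := by
    push_cast
    rw [← h4]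
    nlinarith [mul_le_mul_of_nonneg_right h5 h6]
  exact_mod_cast h7

theorem add_mem_of_eq (h : WeightedDownset V l cost q) {x y w z : ℕ} (hz : z ∈ V) (hx : x ∈ V)
    (hy : y ∈ V) (hw : w ∈ V) (e : z = x + y + w) : x + y ∈ V :=
  h.down x hx y hy w hw (e ▸ hz)

theorem cost_le_add_of_eq (h : WeightedDownset V l cost q) {x y z : ℕ} (hz : z ∈ V) (hx : x ∈ V)
    (hy : y ∈ V) (e : z = x + y) : cost z ≤ l x + l y := by
  subst e
  exact h.cost_le_add x hx y hy hz

theorem le_add_of_eq (h : WeightedDownset V l cost q) {x y z : ℕ} (hz : z ∈ V) (hx : x ∈ V)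
    (hy : y ∈ V) (e : z = x + y) : q ≤ l x + l y + 1 := by
  have := h.cost_le_add_of_eq hz hx hy e
  have := h.le_cost z
  omega

theorem weight_lt_of_eq (h : WeightedDownset V l cost q) {x y z : ℕ} (hz : z ∈ V) (hx : x ∈ V)
    (hy : y ∈ V) (e : z = x + y) : l z < l x := by
  subst e
  exact h.weight_lt x hx y hy hz

theorem add_mem_decomps {x y : ℕ} (hx : x ∈ V) (hy : y ∈ V) (hxy : x + y ∈ V) :
    x + y ∈ decomps V := mem_decomps.2 ⟨hxy, x, hx, y, hy, rfl⟩

theorem mem_decomps_of_not_prim {z : ℕ} (hz : z ∈ V) (hp : z ∉ prims V) : z ∈ decomps V := by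
  by_contra hc
  exact hp (mem_prims.2 ⟨hz, fun h => hc (mem_decomps.2 ⟨hz, h⟩)⟩)

theorem exists_prim_add (h : WeightedDownset V l cost q) {z : ℕ} (hz : z ∈ decomps V) :
    ∃ x ∈ prims V, ∃ w ∈ V, z = x + w := by
  obtain ⟨hzV, hz'⟩ := mem_decomps.1 hz
  rcases h.prim_or hzV with hp | ⟨x, hx, w, hw, e⟩
  · exact absurd hz' (mem_prims.1 hp).2
  · exact ⟨x, hx, w, hw, e.symm⟩

theorem sum_map_le_sum {f : ℕ → ℕ} (L : List ℕ) (hL : L.Nodup) (hV : ∀ x ∈ L, x ∈ V) :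
    (L.map f).sum ≤ ∑ x ∈ V, f x := by
  rw [← List.sum_toFinset f hL]
  exact Finset.sum_le_sum_of_subset fun x hx => hV x (by simpa using hx)

theorem sum_cost_le_mul_card (h : WeightedDownset V l cost q) (D : Finset ℕ) :
    ∑ z ∈ D, cost z ≤ D.card * q := by
  simpa using Finset.sum_le_card_nsmul D cost q fun z _ => h.cost_le z

theorem sum_cost_add_three_le (h : WeightedDownset V l cost q) {D : Finset ℕ} {a b c : ℕ}
    (ha : a ∈ D) (hb : b ∈ D) (hc : c ∈ D) (hab : a ≠ b) (hac : a ≠ c) (hbc : b ≠ c)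
    (ka : cost a < q) (kb : cost b < q) (kc : cost c < q) :
    ∑ z ∈ D, cost z + 3 ≤ D.card * q := by
  have hK : ({a, b, c} : Finset ℕ) ⊆ D := by
    intro z hz
    simp only [Finset.mem_insert, Finset.mem_singleton] at hz
    rcases hz with rfl | rfl | rfl <;> assumption
  have h1 := Finset.sum_sdiff (f := cost) hK
  have h2 := Finset.card_sdiff_add_card_eq_card hK
  have h3 := h.sum_cost_le_mul_card (D \ {a, b, c})
  rw [Finset.card_eq_three.2 ⟨a, b, c, hab, hac, hbc, rfl⟩] at h2
  rw [Finset.sum_insert (by simp [hab, hac]), Finset.sum_insert (by simp [hbc]),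
    Finset.sum_singleton] at h1
  rw [← h2, ← h1, add_mul]
  omega

/-! ### Sums of three primitive elements, not all equal -/

/-- The three ways of splitting off one summand give three disjoint pairs, each of weight at least q
- 1. Each pair also weighs at least 3, because the two-term sums have positive weight and the
primitives strictly more. Both 3(q - 1) and 9 would thus be at most 2q - 1. -/
theorem not_three_distinct (h : WeightedDownset V l cost q) (hl : ∑ x ∈ V, l x < 2 * q)
    {x u v : ℕ} (hx : x ∈ prims V) (hu : u ∈ prims V) (hv : v ∈ prims V) (hxu : x ≠ u)
    (hxv : x ≠ v) (huv : u ≠ v) : x + u + v ∉ V := by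
  intro hz
  have hx' := prims_subset V hx
  have hu' := prims_subset V hu
  have hv' := prims_subset V hv
  have m1 := h.add_mem_of_eq hz hx' hu' hv' (by omega)
  have m2 := h.add_mem_of_eq hz hx' hv' hu' (by omega)
  have m3 := h.add_mem_of_eq hz hu' hv' hx' (by omega)
  have p1 := h.le_add_of_eq hz m1 hv' (by omega)
  have p2 := h.le_add_of_eq hz m2 hu' (by omega)
  have p3 := h.le_add_of_eq hz m3 hx' (by omega)
  have o1 := h.one_le m1 hv' (by convert hz using 1)
  have o2 := h.one_le m2 hu' (by convert hz using 1; omega)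
  have o3 := h.one_le m3 hx' (by convert hz using 1; omega)
  have l1 := h.weight_lt_of_eq m1 hx' hu' rfl
  have l2 := h.weight_lt_of_eq m2 hv' hx' (by omega)
  have l3 := h.weight_lt_of_eq m3 hu' hv' rfl
  have n1 : ∀ a ∈ prims V, a ≠ x + u ∧ a ≠ x + v ∧ a ≠ u + v := fun a ha =>
    ⟨fun e => h.not_prim_add hx' hu' (e ▸ ha), fun e => h.not_prim_add hx' hv' (e ▸ ha),
      fun e => h.not_prim_add hu' hv' (e ▸ ha)⟩
  have n2 := n1 x hx
  have n3 := n1 u hu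
  have n4 := n1 v hv
  have := sum_map_le_sum (V := V) (f := l) [x, u, v, x + u, x + v, u + v]
    (by simp; omega) (by simp; tauto)
  simp at this
  omega

/-- The case of a sum `2 u + x` in `V` where `2 u` and `x + u` are the only decomposable elements
of positive weight. -/
theorem sum_cost_le_of_two_decomps (h : WeightedDownset V l cost q)
    (hp : 3 ≤ (prims V).card + 1) {x u : ℕ} (hx : x ∈ prims V) (hu : u ∈ prims V) (hxu : x ≠ u)
    (hz : u + u + x ∈ V) (hD : ∀ y ∈ decomps V, 1 ≤ l y → y = u + u ∨ y = x + u) :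
    ∑ z ∈ decomps V, cost z ≤ ((prims V).card + 1) * ∑ x ∈ V, l x := by
  have hx' := prims_subset V hx
  have hu' := prims_subset V hu
  have m1 := h.add_mem_of_eq hz hu' hu' hx' rfl
  have m2 := h.add_mem_of_eq hz hx' hu' hu' (by omega)
  have p1 := h.le_add_of_eq hz m1 hx' rfl
  have p2 := h.le_add_of_eq hz m2 hu' (by omega)
  have c2 := h.cost_le_add_of_eq hz m2 hu' (by omega)
  have o1 := h.one_le m1 hx' hz
  have o2 := h.one_le m2 hu' (by convert hz using 1; omega)
  have x0 := h.pos x hx'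
  have u0 := h.pos u hu'
  have rest : ∀ z ∈ decomps V, (∃ x ∈ prims V, ∃ y ∈ prims V, x + y = z) ∨
      z = u + u + u ∨ z = u + u + x := by
    intro z hzD
    obtain ⟨t, ht, w, hw, rfl⟩ := h.exists_prim_add hzD
    have ht' := prims_subset V ht
    have hzV := decomps_subset V hzD
    by_cases hwp : w ∈ prims V
    · exact Or.inl ⟨t, ht, w, hwp, rfl⟩
    right
    -- A proper partial sum of an element of V has positive weight, so `hD` applies to it.
    have key : ∀ s ∈ V, ∀ r ∈ V, t + w = t + s + r → t + s = u + u ∨ t + s = x + u := by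
      intro s hs r hr e
      have hts := h.add_mem_of_eq hzV ht' hs hr e
      exact hD _ (add_mem_decomps ht' hs hts) (h.one_le hts hr (e ▸ hzV))
    have hnt := h.not_prim_add (x := t) (y := u) ht' hu'
    rcases hD w (mem_decomps_of_not_prim hw hwp)
      (h.one_le hw ht' (by rwa [add_comm])) with rfl | rfl
    · rcases key u hu' u hu' (by omega) with e | e <;> omega
    · rcases key u hu' x hx' (by omega) with e | e
      · omega
      · rcases key x hx' u hu' (by omega) with e' | e' <;> omega
  have hW : ({u + u, x + u} : Finset ℕ) ⊆ decomps V := by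
    intro z hz
    simp only [Finset.mem_insert, Finset.mem_singleton] at hz
    rcases hz with rfl | rfl
    · exact add_mem_decomps hu' hu' m1
    · exact add_mem_decomps hx' hu' m2
  have hWs : ∑ z ∈ ({u + u, x + u} : Finset ℕ), (l z : ℤ) = l (u + u) + l (x + u) :=
    Finset.sum_pair (by omega)
  -- The sums 2u and x + u are charged q; pairs are stored in increasing order, whence the two
  -- cases.
  obtain ⟨B, hB, hBs⟩ : ∃ B : Finset (ℕ × ℕ),
      B ⊆ ({p ∈ prims V ×ˢ prims V | p.1 ≤ p.2} : Finset (ℕ × ℕ)) ∧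
      ∑ p ∈ B, ((q : ℤ) - l p.1 - l p.2) = (q - 2 * l u) + (q - l u - l x) := by
    rcases le_total x u with hle | hle
    · refine ⟨{(u, u), (x, u)}, ?_, ?_⟩
      · intro p hp
        simp only [Finset.mem_insert, Finset.mem_singleton] at hp
        rcases hp with rfl | rfl <;> simp [hx, hu, hle]
      · rw [Finset.sum_pair (by simp [Ne.symm hxu])]
        ring
    · refine ⟨{(u, u), (u, x)}, ?_, ?_⟩
      · intro p hp
        simp only [Finset.mem_insert, Finset.mem_singleton] at hp
        rcases hp with rfl | rfl <;> simp [hx, hu, hle]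
      · rw [Finset.sum_pair (by simp [Ne.symm hxu])]
        ring
  by_cases h3 : u + u + u ∈ V
  · have c3 := h.cost_le_add_of_eq h3 m1 hu' rfl
    refine h.sum_cost_le_of_rest hp {u + u + u, u + u + x} _ B hB hW
      (fun z hz => by simpa using rest z hz) ?_
    -- Bounding one q by l(2u) + l(x) + 1 and the other by l(x + u) + l(u) + 1 leaves 2 l(2u) + 2
    -- l(x + u) + 2 on the left. This suffices since both weights are at least 1.
    rw [hBs, hWs, Finset.sum_pair (by omega)]
    omega
  · refine h.sum_cost_le_of_rest hp {u + u + x} _ B hB hW (fun z hz => ?_) ?_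
    · rcases rest z hz with h' | rfl | rfl
      · exact Or.inl h'
      · exact absurd (decomps_subset V hz) h3
      · simp
    · rw [hBs, hWs, Finset.sum_singleton]
      omega

theorem not_prim_of_mem_decomps {z : ℕ} (hz : z ∈ decomps V) : z ∉ prims V := fun hp =>
  (mem_prims.1 hp).2 (mem_decomps.1 hz).2

/-- If `2 u + x` lies in `V` and some decomposable `y` other than `2 u` and `x + u` has positive
weight, then `x`, `u`, `2 u`, `x + u` and `y` carry the whole weight, which is `2 q - 1`. -/
theorem third_decomp_weights (h : WeightedDownset V l cost q)
    (hl : ∑ x ∈ V, l x < 2 * q) {x u y : ℕ} (hx : x ∈ prims V) (hu : u ∈ prims V)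
    (hxu : x ≠ u) (hz : u + u + x ∈ V) (hy : y ∈ decomps V) (hly : 1 ≤ l y)
    (hyu : y ≠ u + u) (hyx : y ≠ x + u) :
    (l y = 1 ∧ l x + l (u + u) + 1 = q ∧ l u + l (x + u) + 1 = q ∧ ∑ x ∈ V, l x + 1 = 2 * q) ∧
    ∀ w ∈ V, 1 ≤ l w → w = x ∨ w = u ∨ w = u + u ∨ w = x + u ∨ w = y := by
  have hx' := prims_subset V hx
  have hu' := prims_subset V hu
  have hy' := decomps_subset V hy
  have m1 := h.add_mem_of_eq hz hu' hu' hx' rfl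
  have m2 := h.add_mem_of_eq hz hx' hu' hu' (by omega)
  have p1 := h.le_add_of_eq hz m1 hx' rfl
  have p2 := h.le_add_of_eq hz m2 hu' (by omega)
  have c1 := h.cost_le_add_of_eq hz m1 hx' rfl
  have o1 := h.one_le m1 hx' hz
  have o2 := h.one_le m2 hu' (by convert hz using 1; omega)
  have l1 := h.weight_lt_of_eq m1 hu' hu' rfl
  have l2 := h.weight_lt_of_eq m2 hx' hu' rfl
  have l3 := h.weight_lt_of_eq m2 hu' hx' (by omega)
  have x0 := h.pos x hx'
  have u0 := h.pos u hu'
  have yx : y ≠ x := fun e => not_prim_of_mem_decomps hy (e ▸ hx)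
  have yu : y ≠ u := fun e => not_prim_of_mem_decomps hy (e ▸ hu)
  have n1 : x ≠ u + u := fun e => h.not_prim_add hu' hu' (e ▸ hx)
  have n2 : u ≠ x + x := fun e => h.not_prim_add hx' hx' (e ▸ hu)
  have hsum := sum_map_le_sum (V := V) (f := l) [x, u, u + u, x + u, y]
    (by simp; omega) (by simp; tauto)
  simp only [List.map_cons, List.map_nil, List.sum_cons, List.sum_nil] at hsum
  -- The disjoint pairs {x, 2u} and {u, x + u} weigh at least q - 1 each and y at least 1. A total
  -- below 2q forces equality everywhere and leaves nothing for a sixth element.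
  refine ⟨by omega, fun w hw hlw => ?_⟩
  by_contra hc
  push Not at hc
  have := sum_map_le_sum (V := V) (f := l) [w, x, u, u + u, x + u, y]
    (by simp; omega) (by simp; tauto)
  simp only [List.map_cons, List.map_nil, List.sum_cons, List.sum_nil] at this
  omega

/-- The possible sums when `2 u + x` lies in `V` and some decomposable `y` other than `2 u` and
`x + u` has positive weight. -/
theorem third_decomp_cover (h : WeightedDownset V l cost q)
    (hl : ∑ x ∈ V, l x < 2 * q) {x u y : ℕ} (hx : x ∈ prims V) (hu : u ∈ prims V)
    (hxu : x ≠ u) (hz : u + u + x ∈ V) (hy : y ∈ decomps V) (hly : 1 ≤ l y)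
    (hyu : y ≠ u + u) (hyx : y ≠ x + u) :
    (∀ z ∈ decomps V, z = u + u ∨ z = x + u ∨ z = x + x ∨ z = u + u + u ∨
      z = u + u + x ∨ z = y + x ∨ z = y + u) ∧
    (y = x + x ∨ y = u + u + u ∨ y = u + u + x) := by
  have hx' := prims_subset V hx
  have hu' := prims_subset V hu
  have hy' := decomps_subset V hy
  have yx : y ≠ x := fun e => not_prim_of_mem_decomps hy (e ▸ hx)
  have yu : y ≠ u := fun e => not_prim_of_mem_decomps hy (e ▸ hu)
  have m1 := h.add_mem_of_eq hz hu' hu' hx' rfl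
  have m2 := h.add_mem_of_eq hz hx' hu' hu' (by omega)
  have x0 := h.pos x hx'
  have u0 := h.pos u hu'
  obtain ⟨_, five⟩ := h.third_decomp_weights hl hx hu hxu hz hy hly hyu hyx
  have n2 : u ≠ x + x := fun e => h.not_prim_add hx' hx' (e ▸ hu)
  have prim_eq : ∀ t ∈ prims V, 1 ≤ l t → t = x ∨ t = u := by
    intro t ht hlt
    have a1 : t ≠ u + u := fun e => h.not_prim_add hu' hu' (e ▸ ht)
    have a2 : t ≠ x + u := fun e => h.not_prim_add hx' hu' (e ▸ ht)
    have a3 : t ≠ y := fun e => not_prim_of_mem_decomps hy (e ▸ ht)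
    have := five t (prims_subset V ht) hlt
    tauto
  have xx_mem : ∀ w ∈ V, ∀ z ∈ V, z = x + x + w → x + x = u + u ∨ x + x = y := by
    intro w hw z hz' e
    have mm := h.add_mem_of_eq hz' hx' hx' hw e
    have := five _ mm (h.one_le mm hw (e ▸ hz'))
    omega
  -- Both summands of a decomposition have positive weight, hence are among the five. The sum x + (x
  -- + u) needs no entry of its own: it forces 2x = y, so it equals y + u.
  have cover : ∀ z ∈ decomps V, z = u + u ∨ z = x + u ∨ z = x + x ∨ z = u + u + u ∨
      z = u + u + x ∨ z = y + x ∨ z = y + u := by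
    intro z hzD
    have hzV := decomps_subset V hzD
    obtain ⟨t, ht, w, hw, e⟩ := h.exists_prim_add hzD
    have f1 := prim_eq t ht (h.one_le (prims_subset V ht) hw (e ▸ hzV))
    have f2 := five w hw (h.one_le hw (prims_subset V ht) (by rwa [add_comm, ← e]))
    rcases f1 with rfl | rfl
    · rcases f2 with rfl | rfl | rfl | rfl | rfl
      · omega
      · omega
      · omega
      · have := xx_mem u hu' z hzV (by omega)
        omega
      · omega
    · omega
  have ycase : y = x + x ∨ y = u + u + u ∨ y = u + u + x := by
    obtain ⟨t, ht, w, hw, e⟩ := h.exists_prim_add hy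
    have t0 := h.pos t (prims_subset V ht)
    have f1 := prim_eq t ht (h.one_le (prims_subset V ht) hw (e ▸ hy'))
    have f2 := five w hw (h.one_le hw (prims_subset V ht) (by rwa [add_comm, ← e]))
    rcases f1 with rfl | rfl
    · rcases f2 with rfl | rfl | rfl | rfl | rfl
      · omega
      · omega
      · omega
      · have := xx_mem u hu' y hy' (by omega)
        omega
      · omega
    · omega
  exact ⟨cover, ycase⟩

/-- The case of a sum `2 u + x` in `V` where some decomposable element other than `2 u` and
`x + u` has positive weight. -/
theorem sum_cost_le_of_third_decomp (h : WeightedDownset V l cost q)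
    (hp : 3 ≤ (prims V).card + 1) (hd : (decomps V).card ≤ 2 * ((prims V).card + 1))
    (hl : ∑ x ∈ V, l x < 2 * q) {x u y : ℕ} (hx : x ∈ prims V) (hu : u ∈ prims V)
    (hxu : x ≠ u) (hz : u + u + x ∈ V) (hy : y ∈ decomps V) (hly : 1 ≤ l y)
    (hyu : y ≠ u + u) (hyx : y ≠ x + u) :
    ∑ z ∈ decomps V, cost z ≤ ((prims V).card + 1) * ∑ x ∈ V, l x := by
  have hx' := prims_subset V hx
  have hu' := prims_subset V hu
  have hy' := decomps_subset V hy
  have m1 := h.add_mem_of_eq hz hu' hu' hx' rfl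
  have m2 := h.add_mem_of_eq hz hx' hu' hu' (by omega)
  have x0 := h.pos x hx'
  have u0 := h.pos u hu'
  obtain ⟨⟨w1, w2, w3, w4⟩, five⟩ := h.third_decomp_weights hl hx hu hxu hz hy hly hyu hyx
  obtain ⟨cover, ycase⟩ := h.third_decomp_cover hl hx hu hxu hz hy hly hyu hyx
  have n1 : x ≠ u + u := fun e => h.not_prim_add hu' hu' (e ▸ hx)
  have n2 : u ≠ x + x := fun e => h.not_prim_add hx' hx' (e ▸ hu)
  have c1 := h.cost_le_add_of_eq hz m1 hx' rfl
  have o1 := h.one_le m1 hx' hz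
  have o2 := h.one_le m2 hu' (by convert hz using 1; omega)
  have l1 := h.weight_lt_of_eq m1 hu' hu' rfl
  have l2 := h.weight_lt_of_eq m2 hx' hu' rfl
  have l3 := h.weight_lt_of_eq m2 hu' hx' (by omega)
  have card_le : (decomps V).card ≤ 7 := by
    refine (Finset.card_le_card (t := {y + u, u + u, x + u, x + x, u + u + u, u + u + x, y + x})
      fun z hz => ?_).trans ((Finset.card_insert_le _ _).trans
        (Nat.succ_le_succ Finset.card_le_six))
    have := cover z hz
    simp only [Finset.mem_insert, Finset.mem_singleton]
    tauto
  have bound := h.sum_cost_le_mul_card (decomps V)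
  have hmul : ∀ k, k ≤ (prims V).card + 1 → k * (2 * q - 1) ≤
      ((prims V).card + 1) * ∑ x ∈ V, l x := fun k hk => Nat.mul_le_mul hk (by omega)
  -- The right side is (p + 1)(2q - 1), and q = l(x) + l(2u) + 1 ≥ 4 since l(x) > l(x + u) ≥ 1.
  -- Hence 7q ≤ 4(2q - 1).
  by_cases h4 : 4 ≤ (prims V).card + 1
  · have := hmul 4 h4
    have : (decomps V).card * q ≤ 7 * q := Nat.mul_le_mul_right q card_le
    omega
  have h3 := hmul 3 hp
  by_cases h5 : (decomps V).card ≤ 5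
  · have : (decomps V).card * q ≤ 5 * q := Nat.mul_le_mul_right q h5
    omega
  have h6 : (decomps V).card = 6 := by omega
  -- For p + 1 = 3 the right side is 6q - 3, so three of the six decomposable elements must cost
  -- less than q.
  suffices ∑ z ∈ decomps V, cost z + 3 ≤ (decomps V).card * q by
    rw [h6] at this
    omega
  have cheap : cost (u + u + x) < q := by omega
  have hzD := add_mem_decomps m1 hx' hz
  -- Six candidates covering a set of six elements all belong to it.
  have mem_all : ∀ a b c d e f : ℕ,
      (∀ z ∈ decomps V, z = a ∨ z = b ∨ z = c ∨ z = d ∨ z = e ∨ z = f) →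
      {a, b, c, d, e, f} = decomps V := by
    intro a b c d e f hall
    refine (Finset.eq_of_subset_of_card_le (fun z hz => ?_) ?_).symm
    · simpa using hall z hz
    · rw [h6]
      exact Finset.card_le_six
  rcases ycase with rfl | rfl | rfl
  · by_cases ha : x + x + x ∈ V
    · have ca := h.cost_le_add_of_eq ha hy' hx' rfl
      by_cases hb : x + x + u ∈ V
      · have cb := h.cost_le_add_of_eq hb hy' hu' rfl
        exact h.sum_cost_add_three_le hzD (add_mem_decomps hy' hx' ha) (add_mem_decomps hy' hu' hb)
          (by omega) (by omega) (by omega) cheap (by omega) (by omega)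
      · have eD := mem_all (u + u) (x + u) (x + x) (u + u + u) (u + u + x) (x + x + x)
          fun z hz => by
            have : z ≠ x + x + u := fun e => hb (e ▸ decomps_subset V hz)
            have := cover z hz
            omega
        have m3 : u + u + u ∈ decomps V := by
          rw [← eD]
          simp
        have c3 := h.cost_le_add_of_eq (decomps_subset V m3) m1 hu' rfl
        have pa := h.le_add_of_eq ha hy' hx' rfl
        exact h.sum_cost_add_three_le hzD (add_mem_decomps hy' hx' ha) m3
          (by omega) (by omega) (by omega) cheap (by omega) (by omega)
    · have eD := mem_all (u + u) (x + u) (x + x) (u + u + u) (u + u + x) (x + x + u)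
          fun z hz => by
            have : z ≠ x + x + x := fun e => ha (e ▸ decomps_subset V hz)
            have := cover z hz
            omega
      have m3 : u + u + u ∈ decomps V := by
        rw [← eD]
        simp
      have hb : x + x + u ∈ decomps V := by
        rw [← eD]
        simp
      have hb' := decomps_subset V hb
      have c3 := h.cost_le_add_of_eq (decomps_subset V m3) m1 hu' rfl
      have cb := h.cost_le_add_of_eq hb' hy' hu' rfl
      have pb := h.le_add_of_eq hb' hy' hu' rfl
      have pb' := h.le_add_of_eq hb' m2 hx' (by omega)
      exact h.sum_cost_add_three_le hzD hb m3
        (by omega) (by omega) (by omega) cheap (by omega) (by omega)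
  · have no : u + u + u + x ∉ V := by
      intro hc
      have mm := h.add_mem_of_eq hc m1 hx' hu' (by omega)
      have := five _ mm (h.one_le mm hu' (by convert hc using 1; omega))
      omega
    have eD := mem_all (u + u) (x + u) (x + x) (u + u + u) (u + u + x) (u + u + u + u)
      fun z hz => by
        have : z ≠ u + u + u + x := fun e => no (e ▸ decomps_subset V hz)
        have := cover z hz
        omega
    have m3 : u + u + u + u ∈ decomps V := by
      rw [← eD]
      simp
    have m4 : x + x ∈ decomps V := by
      rw [← eD]
      simp
    have m3' := decomps_subset V m3
    have c3 := h.cost_le_add_of_eq m3' hy' hu' rfl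
    have p3 := h.le_add_of_eq m3' m1 m1 (by omega)
    have c4 := h.cost_le_add_of_eq (decomps_subset V m4) hx' hx' rfl
    exact h.sum_cost_add_three_le hzD m3 m4
      (by omega) (by omega) (by omega) cheap (by omega) (by omega)
  · exfalso
    have no1 : u + u + x + x ∉ V := by
      intro hc
      have mm := h.add_mem_of_eq hc m2 hx' hu' (by omega)
      have := five _ mm (h.one_le mm hu' (by convert hc using 1; omega))
      omega
    have no2 : u + u + x + u ∉ V := by
      intro hc
      have mm := h.add_mem_of_eq hc m1 hu' hx' (by omega)
      have n3 : x ≠ u + u + u := fun e => h.not_prim_add m1 hu' (e ▸ hx)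
      have := five _ mm (h.one_le mm hx' (by convert hc using 1; omega))
      omega
    refine h5 ((Finset.card_le_card (t := {u + u, x + u, x + x, u + u + u, u + u + x})
      fun z hz => ?_).trans Finset.card_le_five)
    have a1 : z ≠ u + u + x + x := fun e => no1 (e ▸ decomps_subset V hz)
    have a2 : z ≠ u + u + x + u := fun e => no2 (e ▸ decomps_subset V hz)
    have := cover z hz
    simp only [Finset.mem_insert, Finset.mem_singleton]
    tauto

/-! ### All sums of three primitive elements are of the form 3x -/

/-- If all sums of three primitive elements in `V` are of the form `3 x`, then all elements of `V`
are primitive, sums of two primitive elements, or multiples of a primitive element. -/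
theorem eq_mul_of_triples (h : WeightedDownset V l cost q)
    (hA : ∀ x ∈ prims V, ∀ u ∈ prims V, ∀ v ∈ prims V, x + u + v ∈ V → x = u ∧ u = v)
    {z : ℕ} (hz : z ∈ V) :
    z ∈ prims V ∨ (∃ x ∈ prims V, ∃ y ∈ prims V, x + y = z) ∨
      ∃ x ∈ prims V, ∃ k, 3 ≤ k ∧ z = k * x ∧ ∀ j, 1 ≤ j → j ≤ k → j * x ∈ V := by
  induction z using Nat.strong_induction_on with
  | _ z ih =>
    rcases h.prim_or hz with hp | ⟨x, hx, w, hw, rfl⟩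
    · exact Or.inl hp
    right
    have hx' := prims_subset V hx
    have x0 := h.pos x hx'
    rcases ih w (by omega) hw with hwp | ⟨u, hu, v, hv, rfl⟩ | ⟨u, hu, k, hk, rfl, hj⟩
    · exact Or.inl ⟨x, hx, w, hwp, rfl⟩
    · right
      obtain ⟨rfl, rfl⟩ := hA x hx u hu v hv (by rwa [add_assoc])
      refine ⟨x, hx, 3, le_rfl, by ring, fun j h1 h3 => ?_⟩
      interval_cases j
      · simpa using hx'
      · rwa [two_mul]
      · convert hz using 1
        ring
    · right
      have hu' := prims_subset V hu
      -- This partial sum of x + ku is a sum of three primitives, so `hA` gives x = u.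
      have h2 : x + 2 * u ∈ V := by
        refine h.add_mem_of_eq hz hx' (hj 2 (by omega) (by omega))
          (hj (k - 2) (by omega) (by omega)) ?_
        rw [add_assoc, ← add_mul]
        congr 2
        omega
      obtain ⟨rfl, -⟩ := hA x hx u hu u hu (by convert h2 using 1; ring)
      refine ⟨x, hx, k + 1, by omega, by ring, fun j h1 h3 => ?_⟩
      rcases Nat.eq_or_lt_of_le h3 with rfl | hlt
      · convert hz using 1
        ring
      · exact hj j h1 (by omega)

/-- The case where all sums of more than two primitive elements are of the form `3 x`. -/
theorem sum_cost_le_of_triple (h : WeightedDownset V l cost q) (hp : 3 ≤ (prims V).card + 1)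
    (hT : ∀ z ∈ decomps V, (∃ x ∈ prims V, ∃ y ∈ prims V, x + y = z) ∨
      ∃ x ∈ prims V, z = 3 * x) :
    ∑ z ∈ decomps V, cost z ≤ ((prims V).card + 1) * ∑ x ∈ V, l x := by
  classical
  set X := {x ∈ prims V | 3 * x ∈ V} with hX
  have hXm : ∀ x ∈ X, x ∈ prims V ∧ x ∈ V ∧ 3 * x ∈ V ∧ 2 * x ∈ V := by
    intro x hx
    obtain ⟨h1, h3⟩ := Finset.mem_filter.1 hx
    have hx' := prims_subset V h1
    have := h.add_mem_of_eq h3 hx' hx' hx' (by omega)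
    exact ⟨h1, hx', h3, by rwa [two_mul]⟩
  -- Charging q for 2x, the weight 3 l(2x) also pays for 3x: cost(3x) ≤ l(x) + l(2x) and q ≤ l(x) +
  -- l(2x) + 1 leave 2 l(2x) + 1 ≤ 3 l(2x).
  refine h.sum_cost_le_of_rest hp (X.image (3 * ·)) (X.image (2 * ·))
    (X.image fun x => (x, x)) ?_ ?_ ?_ ?_
  · intro p hp
    obtain ⟨x, hx, rfl⟩ := Finset.mem_image.1 hp
    simp [(hXm x hx).1]
  · intro p hp
    obtain ⟨x, hx, rfl⟩ := Finset.mem_image.1 hp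
    obtain ⟨-, h1, -, h2⟩ := hXm x hx
    exact mem_decomps.2 ⟨h2, x, h1, x, h1, (two_mul x).symm⟩
  · intro z hz
    rcases hT z hz with h' | ⟨x, hx, rfl⟩
    · exact Or.inl h'
    · exact Or.inr (Finset.mem_image.2
        ⟨x, Finset.mem_filter.2 ⟨hx, decomps_subset V hz⟩, rfl⟩)
  · rw [Finset.sum_image (by intro; simp), Finset.sum_image (by intro; simp),
      Finset.sum_image (by intro; simp), ← Finset.sum_add_distrib, Finset.mul_sum]
    refine Finset.sum_le_sum fun x hx => ?_
    obtain ⟨-, h1, h3, h2⟩ := hXm x hx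
    have c3 := h.cost_le_add_of_eq h3 h1 h2 (by omega)
    have p3 := h.le_add_of_eq h3 h1 h2 (by omega)
    have o2 := h.one_le h2 h1 (by convert h3 using 1; omega)
    have := h.cost_le (3 * x)
    dsimp only
    omega

/-- The case where the sums of more than two primitive elements are multiples of a primitive
element `x` such that `4 x` lies in `V`. -/
theorem sum_cost_le_of_multiples (h : WeightedDownset V l cost q) (hp : 3 ≤ (prims V).card + 1)
    {x : ℕ} (hx : x ∈ prims V) (hl : ∑ x ∈ V, l x < 2 * q) (m2 : 2 * x ∈ V) (m3 : 3 * x ∈ V)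
    (m4 : 4 * x ∈ V)
    (hT : ∀ z ∈ decomps V, (∃ x ∈ prims V, ∃ y ∈ prims V, x + y = z) ∨
      z = 3 * x ∨ z = 4 * x ∨ z = 5 * x) :
    ∑ z ∈ decomps V, cost z ≤ ((prims V).card + 1) * ∑ x ∈ V, l x := by
  have hx' := prims_subset V hx
  have x0 := h.pos x hx'
  have l2 := h.weight_lt_of_eq m2 hx' hx' (by omega)
  have l3 := h.weight_lt_of_eq m3 m2 hx' (by omega)
  have l4 := h.weight_lt_of_eq m4 m3 hx' (by omega)
  have p4 := h.le_add_of_eq m4 hx' m3 (by omega)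
  have p4' := h.le_add_of_eq m4 m2 m2 (by omega)
  have c3 := h.cost_le_add_of_eq m3 hx' m2 (by omega)
  have c4 := h.cost_le_add_of_eq m4 m2 m2 (by omega)
  have k3 := h.cost_le (3 * x)
  have k4 := h.cost_le (4 * x)
  have d2 : 2 * x ∈ decomps V := mem_decomps.2 ⟨m2, x, hx', x, hx', by omega⟩
  have d3 : 3 * x ∈ decomps V := mem_decomps.2 ⟨m3, x, hx', _, m2, by omega⟩
  have d4 : 4 * x ∈ decomps V := mem_decomps.2 ⟨m4, x, hx', _, m3, by omega⟩
  have hB : ({(x, x)} : Finset (ℕ × ℕ)) ⊆ {p ∈ prims V ×ˢ prims V | p.1 ≤ p.2} := by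
    simp [hx]
  by_cases m5 : 5 * x ∈ V
  · have l5 := h.weight_lt_of_eq m5 m4 hx' (by omega)
    have p5 := h.le_add_of_eq m5 hx' m4 (by omega)
    have p5' := h.le_add_of_eq m5 m2 m3 (by omega)
    have k5 := h.cost_le (5 * x)
    -- The strict drop makes these weights at least 4, 3, 2, 1, so a total below 2q forces q ≥ 6.
    -- Then 5(q - 1) + 1 ≥ 4q, which covers 3x, 4x, 5x and the charge for 2x.
    have hs := sum_map_le_sum (V := V) (f := l) [x, 2 * x, 3 * x, 4 * x]
      (by simp; omega) (by simp; tauto)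
    simp only [List.map_cons, List.map_nil, List.sum_cons, List.sum_nil] at hs
    refine h.sum_cost_le_of_rest hp {3 * x, 4 * x, 5 * x} {2 * x, 3 * x, 4 * x} _ hB ?_
      (fun z hz => by simpa using hT z hz) ?_
    · intro z hz
      simp only [Finset.mem_insert, Finset.mem_singleton] at hz
      rcases hz with rfl | rfl | rfl <;> assumption
    · rw [Finset.sum_singleton, Finset.sum_insert (by simp; omega), Finset.sum_pair (by omega),
        Finset.sum_insert (by simp; omega), Finset.sum_pair (by omega)]
      dsimp only
      omega
  · have hs := sum_map_le_sum (V := V) (f := l) [x, 2 * x, 3 * x]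
      (by simp; omega) (by simp; tauto)
    simp only [List.map_cons, List.map_nil, List.sum_cons, List.sum_nil] at hs
    refine h.sum_cost_le_of_rest hp {3 * x, 4 * x} {2 * x, 3 * x} _ hB ?_ (fun z hz => ?_) ?_
    · intro z hz
      simp only [Finset.mem_insert, Finset.mem_singleton] at hz
      rcases hz with rfl | rfl <;> assumption
    · have : z ≠ 5 * x := fun e => m5 (e ▸ decomps_subset V hz)
      rcases hT z hz with h' | h'
      · exact Or.inl h'
      · right
        simp only [Finset.mem_insert, Finset.mem_singleton]
        omega
    · rw [Finset.sum_singleton, Finset.sum_pair (by omega), Finset.sum_pair (by omega)]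
      dsimp only
      omega

/-- The pairs {x, 3x} and {y, 2y} would weigh at least q - 1 each and 2x at least 2, a total of 2q.
These elements are distinct; in particular 3x = 2y would make 4x = y + y + x a mixed triple. -/
theorem three_mul_not_mem (h : WeightedDownset V l cost q) (hl : ∑ x ∈ V, l x < 2 * q)
    (hA : ∀ x ∈ prims V, ∀ u ∈ prims V, ∀ v ∈ prims V, x + u + v ∈ V → x = u ∧ u = v)
    {x y : ℕ} (hx : x ∈ prims V) (m2 : 2 * x ∈ V) (m3 : 3 * x ∈ V) (m4 : 4 * x ∈ V)
    (hy : y ∈ prims V) (hyx : y ≠ x) : 3 * y ∉ V := by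
  intro k3
  have hx' := prims_subset V hx
  have hy' := prims_subset V hy
  have x0 := h.pos x hx'
  have y0 := h.pos y hy'
  have k2 : 2 * y ∈ V := by
    have := h.add_mem_of_eq k3 hy' hy' hy' (by omega)
    rwa [two_mul]
  have l2 := h.weight_lt_of_eq m2 hx' hx' (by omega)
  have l3 := h.weight_lt_of_eq m3 m2 hx' (by omega)
  have l4 := h.weight_lt_of_eq m4 m3 hx' (by omega)
  have p4 := h.le_add_of_eq m4 hx' m3 (by omega)
  have p4' := h.le_add_of_eq m4 m2 m2 (by omega)
  have p3 := h.le_add_of_eq k3 hy' k2 (by omega)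
  have l2' := h.weight_lt_of_eq k2 hy' hy' (by omega)
  have l3' := h.weight_lt_of_eq k3 k2 hy' (by omega)
  have n1 : y ≠ 2 * x := fun e => h.not_prim_add hx' hx' (by rwa [← two_mul, ← e])
  have n2 : x ≠ 2 * y := fun e => h.not_prim_add hy' hy' (by rwa [← two_mul, ← e])
  have n3 : y ≠ 3 * x := fun e => h.not_prim_add (y := x) m2 hx' (by
    rwa [← Nat.succ_mul, ← e])
  have n4 : 3 * x ≠ 2 * y := fun e => hyx (hA y hy y hy x hx (by
    convert m4 using 1
    omega)).2
  have := sum_map_le_sum (V := V) (f := l) [x, 2 * x, 3 * x, y, 2 * y]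
    (by simp; omega) (by simp; tauto)
  simp only [List.map_cons, List.map_nil, List.sum_cons, List.sum_nil] at this
  omega

/-- In a weighted downset with `p ≥ 2` primitive and at most `2 (p + 1)` decomposable elements, the
cost of the decomposable elements is at most `p + 1` times the total weight. -/
theorem sum_cost_le (h : WeightedDownset V l cost q)
    (hp : 3 ≤ (prims V).card + 1) (hd : (decomps V).card ≤ 2 * ((prims V).card + 1)) :
    ∑ z ∈ decomps V, cost z ≤ ((prims V).card + 1) * ∑ x ∈ V, l x := by
  by_cases hl : 2 * q ≤ ∑ x ∈ V, l x
  · calc _ ≤ (decomps V).card * q := h.sum_cost_le_mul_card _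
      _ ≤ (2 * ((prims V).card + 1)) * q := Nat.mul_le_mul_right q hd
      _ = ((prims V).card + 1) * (2 * q) := by ring
      _ ≤ _ := Nat.mul_le_mul_left _ hl
  push Not at hl
  by_cases hA : ∃ x ∈ prims V, ∃ u ∈ prims V, x ≠ u ∧ u + u + x ∈ V
  · obtain ⟨x, hx, u, hu, hxu, hz⟩ := hA
    by_cases hy : ∃ y ∈ decomps V, 1 ≤ l y ∧ y ≠ u + u ∧ y ≠ x + u
    · obtain ⟨y, hy, hly, hyu, hyx⟩ := hy
      exact h.sum_cost_le_of_third_decomp hp hd hl hx hu hxu hz hy hly hyu hyx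
    · push Not at hy
      refine h.sum_cost_le_of_two_decomps hp hx hu hxu hz fun y hyD hly => ?_
      by_cases e : y = u + u
      · exact Or.inl e
      · exact Or.inr (hy y hyD hly e)
  push Not at hA
  have hA' : ∀ x ∈ prims V, ∀ u ∈ prims V, ∀ v ∈ prims V, x + u + v ∈ V → x = u ∧ u = v := by
    intro x hx u hu v hv hz
    by_cases h1 : x = u
    · subst h1
      by_cases h2 : v = x
      · exact ⟨rfl, h2.symm⟩
      · exact absurd hz (hA v hv x hu h2)
    by_cases h2 : u = v
    · subst h2
      exact absurd (by convert hz using 1; ring) (hA x hx u hu h1)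
    by_cases h3 : x = v
    · subst h3
      exact absurd (by convert hz using 1; ring) (hA u hu x hx (Ne.symm h1))
    · exact absurd hz (h.not_three_distinct hl hx hu hv h1 h3 h2)
  by_cases h4 : ∃ x ∈ prims V, 2 * x ∈ V ∧ 3 * x ∈ V ∧ 4 * x ∈ V
  · obtain ⟨x, hx, m2, m3, m4⟩ := h4
    have hx' := prims_subset V hx
    have x0 := h.pos x hx'
    refine h.sum_cost_le_of_multiples hp hx hl m2 m3 m4 fun z hz => ?_
    rcases h.eq_mul_of_triples hA' (decomps_subset V hz) with hzp | hz2 | ⟨y, hy, k, hk, e, hj⟩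
    · exact absurd hzp (not_prim_of_mem_decomps hz)
    · exact Or.inl hz2
    right
    by_cases hyx : y = x
    · subst hyx
      by_cases k5 : k ≤ 5
      · interval_cases k <;> simp [e]
      -- With 6x in V the pairs {x, 5x} and {2x, 4x} weigh at least q - 1 each and 3x at least 3,
      -- exceeding the total.
      exfalso
      have m5 := hj 5 (by omega) (by omega)
      have m6 := hj 6 (by omega) (by omega)
      have l2 := h.weight_lt_of_eq m2 hx' hx' (by omega)
      have l3 := h.weight_lt_of_eq m3 m2 hx' (by omega)
      have l4 := h.weight_lt_of_eq m4 m3 hx' (by omega)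
      have l5 := h.weight_lt_of_eq m5 m4 hx' (by omega)
      have l6 := h.weight_lt_of_eq m6 m5 hx' (by omega)
      have p1 := h.le_add_of_eq m6 hx' m5 (by omega)
      have p2 := h.le_add_of_eq m6 m2 m4 (by omega)
      have p3 := h.le_add_of_eq m6 m3 m3 (by omega)
      have := sum_map_le_sum (V := V) (f := l) [y, 2 * y, 3 * y, 4 * y, 5 * y]
        (by simp; omega) (by simp; tauto)
      simp only [List.map_cons, List.map_nil, List.sum_cons, List.sum_nil] at this
      omega
    · exact absurd (hj 3 (by omega) hk) (h.three_mul_not_mem hl hA' hx m2 m3 m4 hy hyx)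
  · refine h.sum_cost_le_of_triple hp fun z hz => ?_
    rcases h.eq_mul_of_triples hA' (decomps_subset V hz) with hzp | hz2 | ⟨y, hy, k, hk, e, hj⟩
    · exact absurd hzp (not_prim_of_mem_decomps hz)
    · exact Or.inl hz2
    rcases Nat.eq_or_lt_of_le hk with rfl | hlt
    · exact Or.inr ⟨y, hy, e⟩
    · exact absurd ⟨y, hy, hj 2 (by omega) (by omega), hj 3 (by omega) (by omega),
        hj 4 (by omega) (by omega)⟩ h4

end WeightedDownset

/-! ### The Apéry set of a numerical semigroup -/

namespace NumericalSemigroup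

theorem zero_mem (S : NumericalSemigroup) : 0 ∈ S := S.toAddSubmonoid.zero_mem

theorem add_mem (S : NumericalSemigroup) {a b : ℕ} (ha : a ∈ S) (hb : b ∈ S) : a + b ∈ S :=
  S.toAddSubmonoid.add_mem ha hb

theorem nat_mul_mem (S : NumericalSemigroup) {a : ℕ} (k : ℕ) (ha : a ∈ S) : k * a ∈ S := by
  induction k with
  | zero => simpa using S.zero_mem
  | succ k ih =>
    rw [Nat.succ_mul]
    exact S.add_mem ih ha

theorem multiplicity_mem (S : NumericalSemigroup) : S.multiplicity ∈ S :=
  S.isLeast_multiplicity.1.1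

theorem multiplicity_pos (S : NumericalSemigroup) : 0 < S.multiplicity :=
  Nat.pos_of_ne_zero S.isLeast_multiplicity.1.2

theorem multiplicity_le (S : NumericalSemigroup) {a : ℕ} (ha : a ∈ S) (h0 : a ≠ 0) :
    S.multiplicity ≤ a := S.isLeast_multiplicity.2 ⟨ha, h0⟩

theorem frobenius_ne (S : NumericalSemigroup) {a : ℕ} (ha : a ∈ S) : (a : ℤ) ≠ S.frobenius :=
  fun h => S.isGreatest_frobenius.1 ⟨a, ha, h⟩

theorem le_frobenius_of_not_mem (S : NumericalSemigroup) {a : ℕ} (ha : a ∉ S) :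
    (a : ℤ) ≤ S.frobenius := by
  by_contra hc
  exact ha (S.mem_of_frobenius_lt (not_le.1 hc))

theorem neg_one_le_frobenius (S : NumericalSemigroup) : -1 ≤ S.frobenius :=
  S.isGreatest_frobenius.2 (by rintro ⟨a, -, h⟩; omega)

/-- The conductor as a natural number. -/
noncomputable def natConductor (S : NumericalSemigroup) : ℕ := S.conductor.toNat

theorem natConductor_eq (S : NumericalSemigroup) : (S.natConductor : ℤ) = S.frobenius + 1 := by
  have := S.neg_one_le_frobenius
  unfold natConductor conductor
  omega

theorem mem_of_natConductor_le (S : NumericalSemigroup) {a : ℕ} (h : S.natConductor ≤ a) :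
    a ∈ S := S.mem_of_frobenius_lt (by have := S.natConductor_eq; omega)

open Classical in
/-- The nonzero Apéry elements of `S` with respect to its multiplicity. -/
noncomputable def apery (S : NumericalSemigroup) : Finset ℕ :=
  {w ∈ Finset.range (S.natConductor + S.multiplicity) |
    w ∈ S ∧ w ≠ 0 ∧ ∀ s ∈ S, s + S.multiplicity ≠ w}

theorem mem_apery (S : NumericalSemigroup) {w : ℕ} :
    w ∈ S.apery ↔ w ∈ S ∧ w ≠ 0 ∧ ∀ s ∈ S, s + S.multiplicity ≠ w := by
  simp only [apery, Finset.mem_filter, Finset.mem_range, and_iff_right_iff_imp]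
  rintro ⟨-, -, h⟩
  by_contra hc
  exact h (w - S.multiplicity) (S.mem_of_natConductor_le (by omega)) (by omega)

theorem apery_lt (S : NumericalSemigroup) {w : ℕ} (hw : w ∈ S.apery) :
    w < S.natConductor + S.multiplicity := by
  simp only [apery, Finset.mem_filter, Finset.mem_range] at hw
  exact hw.1

theorem multiplicity_lt_of_mem_apery (S : NumericalSemigroup) {w : ℕ} (hw : w ∈ S.apery) :
    S.multiplicity < w := by
  obtain ⟨h1, h2, h3⟩ := S.mem_apery.1 hw
  refine lt_of_le_of_ne (S.multiplicity_le h1 h2) fun e => h3 0 S.zero_mem (by omega)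

theorem mem_apery_of_add (S : NumericalSemigroup) {x y : ℕ} (hx : x ∈ S) (hx0 : x ≠ 0)
    (hy : y ∈ S) (h : x + y ∈ S.apery) : x ∈ S.apery :=
  S.mem_apery.2 ⟨hx, hx0, fun s hs e =>
    (S.mem_apery.1 h).2.2 (s + y) (S.add_mem hs hy) (by omega)⟩

theorem primitives_eq (S : NumericalSemigroup) :
    S.primitives = insert S.multiplicity (prims S.apery : Set ℕ) := by
  ext w
  simp only [Set.mem_insert_iff, Finset.mem_coe, mem_prims]
  constructor
  · rintro ⟨⟨hw, hw0⟩, hd⟩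
    by_cases hwm : w = S.multiplicity
    · exact Or.inl hwm
    refine Or.inr ⟨S.mem_apery.2 ⟨hw, hw0, fun s hs e => ?_⟩, ?_⟩
    · exact hd ⟨s, ⟨hs, by omega⟩, S.multiplicity, S.isLeast_multiplicity.1, e⟩
    · rintro ⟨x, hx, y, hy, e⟩
      obtain ⟨hx1, hx2, -⟩ := S.mem_apery.1 hx
      obtain ⟨hy1, hy2, -⟩ := S.mem_apery.1 hy
      exact hd ⟨x, ⟨hx1, hx2⟩, y, ⟨hy1, hy2⟩, e⟩
  · rintro (rfl | ⟨hw, hd⟩)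
    · refine ⟨S.isLeast_multiplicity.1, ?_⟩
      rintro ⟨x, hx, y, hy, e⟩
      have := S.multiplicity_le hx.1 hx.2
      have := hy.2
      omega
    · obtain ⟨h1, h2, -⟩ := S.mem_apery.1 hw
      refine ⟨⟨h1, h2⟩, ?_⟩
      rintro ⟨x, hx, y, hy, rfl⟩
      exact hd ⟨x, S.mem_apery_of_add hx.1 hx.2 hy.1 hw, y,
        S.mem_apery_of_add hy.1 hy.2 hx.1 (by rwa [add_comm]), rfl⟩

theorem embeddingDimension_eq (S : NumericalSemigroup) :
    S.embeddingDimension = (prims S.apery).card + 1 := by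
  unfold embeddingDimension
  rw [primitives_eq, Set.ncard_insert_of_notMem, Set.ncard_coe_finset]
  intro h
  have := S.multiplicity_lt_of_mem_apery (prims_subset _ (Finset.mem_coe.1 h))
  omega

theorem eq_of_mod_eq (S : NumericalSemigroup) {w v : ℕ} (hw : w ∈ insert 0 S.apery)
    (hv : v ∈ insert 0 S.apery) (e : w % S.multiplicity = v % S.multiplicity) : w = v := by
  have key : ∀ w v : ℕ, w ∈ insert 0 S.apery → v ∈ insert 0 S.apery →
      w % S.multiplicity = v % S.multiplicity → ¬ w < v := by
    intro w v hw hv e hlt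
    have hwS : w ∈ S := by
      rcases Finset.mem_insert.1 hw with rfl | hw
      · exact S.zero_mem
      · exact (S.mem_apery.1 hw).1
    rcases Finset.mem_insert.1 hv with rfl | hv
    · omega
    obtain ⟨k, hk⟩ := (Nat.modEq_iff_dvd' hlt.le).1 e
    have hk0 : k ≠ 0 := by
      rintro rfl
      omega
    obtain ⟨j, rfl⟩ := Nat.exists_eq_succ_of_ne_zero hk0
    refine (S.mem_apery.1 hv).2.2 (w + j * S.multiplicity)
      (S.add_mem hwS (S.nat_mul_mem j S.multiplicity_mem)) ?_
    rw [Nat.succ_eq_add_one, mul_add, mul_comm] at hk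
    omega
  have h1 := key w v hw hv e
  have h2 := key v w hv hw e.symm
  omega

theorem card_apery (S : NumericalSemigroup) : S.apery.card + 1 = S.multiplicity := by
  classical
  have h0 : 0 ∉ S.apery := fun h => (S.mem_apery.1 h).2.1 rfl
  rw [← Finset.card_insert_of_notMem h0]
  conv_rhs => rw [← Finset.card_range S.multiplicity]
  have hm := S.multiplicity_pos
  refine Finset.card_bij (fun w _ => w % S.multiplicity)
    (fun w _ => Finset.mem_range.2 (Nat.mod_lt w hm))
    (fun w hw v hv e => S.eq_of_mod_eq hw hv e) fun r hr => ?_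
  have hr' := Finset.mem_range.1 hr
  have hex : ∃ n, n ∈ S ∧ n % S.multiplicity = r := by
    refine ⟨r + S.multiplicity * S.natConductor, S.mem_of_natConductor_le ?_, ?_⟩
    · nlinarith
    · rw [Nat.add_mul_mod_self_left, Nat.mod_eq_of_lt hr']
  refine ⟨Nat.find hex, ?_, (Nat.find_spec hex).2⟩
  rw [Finset.mem_insert]
  by_cases hz : Nat.find hex = 0
  · exact Or.inl hz
  · refine Or.inr (S.mem_apery.2 ⟨(Nat.find_spec hex).1, hz, fun s hs e => ?_⟩)
    refine Nat.find_min hex (m := s) (by omega) ⟨hs, ?_⟩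
    rw [← (Nat.find_spec hex).2, ← e, Nat.add_mod_right]

/-! ### Levels, and Wilf's conjecture for embedding dimension at least 3 -/

/-- The number of elements of the class `w + m ℕ` that are smaller than the conductor. -/
noncomputable def level (S : NumericalSemigroup) (w : ℕ) : ℕ :=
  (S.natConductor - w + (S.multiplicity - 1)) / S.multiplicity

theorem lt_level_iff (S : NumericalSemigroup) {w k : ℕ} :
    k < S.level w ↔ w + k * S.multiplicity < S.natConductor := by
  have hm := S.multiplicity_pos
  rw [level, Nat.lt_iff_add_one_le, Nat.le_div_iff_mul_le hm, add_mul]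
  omega

theorem level_mul_lt (S : NumericalSemigroup) {w : ℕ} (h : 0 < S.level w) :
    w + S.level w * S.multiplicity < S.natConductor + S.multiplicity := by
  obtain ⟨k, hk⟩ := Nat.exists_eq_succ_of_ne_zero h.ne'
  have := S.lt_level_iff.1 (hk ▸ Nat.lt_succ_self k)
  rw [hk, Nat.succ_mul]
  omega

theorem le_add_level_mul (S : NumericalSemigroup) (w : ℕ) :
    S.natConductor ≤ w + S.level w * S.multiplicity :=
  not_lt.1 fun h => lt_irrefl _ (S.lt_level_iff.2 h)

/-- The map (w, k) ↦ w + km is injective, as distinct Apéry elements lie in distinct classes modulo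
m. -/
theorem level_sum_le (S : NumericalSemigroup) :
    S.level 0 + ∑ w ∈ S.apery, S.level w ≤ S.leftPart.ncard := by
  classical
  have h0 : 0 ∉ S.apery := fun h => (S.mem_apery.1 h).2.1 rfl
  rw [← Finset.sum_insert h0]
  have hcard : ∑ w ∈ insert 0 S.apery, S.level w
      = ((insert 0 S.apery).sigma fun w => Finset.range (S.level w)).card := by
    simp
  rw [hcard, ← Set.ncard_coe_finset]
  refine Set.ncard_le_ncard_of_injOn (fun p => p.1 + p.2 * S.multiplicity) ?_ ?_
    S.finite_leftPart
  · rintro ⟨w, k⟩ hp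
    simp only [Finset.mem_coe, Finset.mem_sigma, Finset.mem_range] at hp
    have hwS : w ∈ S := by
      rcases Finset.mem_insert.1 hp.1 with rfl | hw
      · exact S.zero_mem
      · exact (S.mem_apery.1 hw).1
    have hmem := S.add_mem hwS (S.nat_mul_mem k S.multiplicity_mem)
    have h1 := S.lt_level_iff.1 hp.2
    have h2 := S.frobenius_ne hmem
    have h3 := S.natConductor_eq
    refine ⟨hmem, ?_⟩
    dsimp only
    omega
  · rintro ⟨w, k⟩ hp ⟨v, j⟩ hp' e
    simp only [Finset.mem_coe, Finset.mem_sigma, Finset.mem_range] at hp hp' e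
    have e1 : w = v := by
      refine S.eq_of_mod_eq hp.1 hp'.1 ?_
      have := congrArg (· % S.multiplicity) e
      simpa using this
    subst e1
    have e2 : k = j := Nat.eq_of_mul_eq_mul_right S.multiplicity_pos (by omega)
    rw [e2]

/-- The cost of an Apéry element `z`: the depth of `S`, minus one if `z` is large. -/
noncomputable def cost (S : NumericalSemigroup) (z : ℕ) : ℕ :=
  if 2 * S.natConductor + S.multiplicity ≤ z + S.level 0 * S.multiplicity
  then S.level 0 - 1 else S.level 0

/-- Weights drop strictly because nonzero Apéry elements exceed m. For the cost, adding c ≤ x +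
l(x)m and c ≤ y + l(y)m bounds (l(x) + l(y))m below by 2c - (x + y). An Apéry element is below c +
m, which gives q - 1, and the threshold in `cost` is where this improves to q. -/
theorem weightedDownset (S : NumericalSemigroup) (hc : 0 < S.natConductor) :
    WeightedDownset S.apery S.level S.cost (S.level 0) := by
  have hm := S.multiplicity_pos
  have down : ∀ x ∈ S.apery, ∀ y ∈ S.apery, x + y ∈ S.apery → 1 ≤ S.level x := by
    intro x hx y hy hxy
    have := S.apery_lt hxy
    have := S.multiplicity_lt_of_mem_apery hy
    exact S.lt_level_iff.2 (by omega)
  refine ⟨fun x hx => ?_, fun x hx y hy z hz h => ?_, fun x hx y hy h => ?_,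
    fun x hx y hy h => ?_, fun z => ?_, fun z => ?_⟩
  · exact Nat.pos_of_ne_zero (S.mem_apery.1 hx).2.1
  · have hx' := (S.mem_apery.1 hx)
    exact S.mem_apery_of_add (S.add_mem hx'.1 (S.mem_apery.1 hy).1) (by omega)
      (S.mem_apery.1 hz).1 h
  · have h1 := down x hx y hy h
    rcases Nat.eq_zero_or_pos (S.level (x + y)) with h0 | h0
    · omega
    · refine S.lt_level_iff.2 ?_
      have := S.level_mul_lt h0
      have := S.multiplicity_lt_of_mem_apery hy
      omega
  · have h1 := S.le_add_level_mul x
    have h2 := S.le_add_level_mul y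
    have h3 := S.apery_lt h
    have h4 : 0 < S.level 0 := S.lt_level_iff.2 (by simpa using hc)
    have h5 := S.level_mul_lt h4
    obtain ⟨k, hk⟩ := Nat.exists_eq_succ_of_ne_zero h4.ne'
    have h6 : S.level 0 * S.multiplicity = k * S.multiplicity + S.multiplicity := by
      rw [hk, Nat.succ_mul]
    unfold cost
    split_ifs with hlt
    · have : (k - 1) * S.multiplicity < (S.level x + S.level y) * S.multiplicity := by
        rw [add_mul]
        -- Here k = q - 1; for k = 0 the subtraction truncates, and l(x) ≥ 1 is used instead.
        rcases Nat.eq_zero_or_pos k with rfl | hk0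
        · have := Nat.mul_le_mul_right S.multiplicity (down x hx y hy h)
          omega
        · have : (k - 1) * S.multiplicity + S.multiplicity = k * S.multiplicity := by
            rw [← Nat.succ_mul]
            congr
            omega
          omega
      have := Nat.lt_of_mul_lt_mul_right this
      omega
    · have : k * S.multiplicity < (S.level x + S.level y) * S.multiplicity := by
        rw [add_mul]
        omega
      have := Nat.lt_of_mul_lt_mul_right this
      omega
  · unfold cost
    split_ifs <;> omega
  · unfold cost
    split_ifs <;> omega

/-- With r = qm - c, the discounted elements lie in the interval [c + m - r, c + m), so there are at
most r of them. -/
theorem card_mul_level_le (S : NumericalSemigroup) :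
    (decomps S.apery).card * S.level 0 + S.natConductor
      ≤ ∑ z ∈ decomps S.apery, S.cost z + S.level 0 * S.multiplicity := by
  classical
  have h1 := S.le_add_level_mul 0
  set H := {z ∈ decomps S.apery |
    2 * S.natConductor + S.multiplicity ≤ z + S.level 0 * S.multiplicity} with hH
  have hHc : H.card + S.natConductor ≤ S.level 0 * S.multiplicity := by
    have : H ⊆ Finset.Ico (2 * S.natConductor + S.multiplicity - S.level 0 * S.multiplicity)
        (S.natConductor + S.multiplicity) := by
      intro z hz
      obtain ⟨hz1, hz2⟩ := Finset.mem_filter.1 hz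
      have := S.apery_lt (decomps_subset _ hz1)
      rw [Finset.mem_Ico]
      omega
    have := Finset.card_le_card this
    rw [Nat.card_Ico] at this
    omega
  have h2 : (decomps S.apery).card * S.level 0 ≤ ∑ z ∈ decomps S.apery, S.cost z + H.card := by
    rw [hH, Finset.card_filter, ← Finset.sum_add_distrib, ← smul_eq_mul]
    refine Finset.card_nsmul_le_sum _ _ _ fun z _ => ?_
    unfold cost
    split_ifs <;> omega
  omega

/-- Since m = e + |D|, the count of discounts gives c ≤ eq + ∑ cost ≤ eq + e ∑ l ≤ e|L|. -/
theorem satisfiesWilf_of_three_le (S : NumericalSemigroup) (h3 : 3 ≤ S.embeddingDimension)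
    (h : S.multiplicity ≤ 3 * S.embeddingDimension) : S.SatisfiesWilf := by
  unfold SatisfiesWilf
  have hcond := S.natConductor_eq
  rcases Nat.eq_zero_or_pos S.natConductor with hc | hc
  · have : S.conductor = 0 := by
      unfold conductor
      omega
    rw [this]
    positivity
  have he := S.embeddingDimension_eq
  have hcard := S.card_apery
  have hpd := card_prims_add_card_decomps S.apery
  have main := (S.weightedDownset hc).sum_cost_le (by omega) (by omega)
  have h1 := S.card_mul_level_le
  have h2 := Nat.mul_le_mul_left S.embeddingDimension S.level_sum_le
  rw [← he] at main
  have h4 : S.level 0 * S.multiplicity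
      = S.embeddingDimension * S.level 0 + (decomps S.apery).card * S.level 0 := by
    rw [← add_mul, mul_comm]
    congr 1
    omega
  rw [mul_add] at h2
  have h5 : S.natConductor ≤ S.embeddingDimension * S.leftPart.ncard := by omega
  unfold conductor
  rw [← hcond, ge_iff_le]
  exact_mod_cast h5

/-! ### Embedding dimension at most 2 -/

theorem exists_primitive_add (S : NumericalSemigroup) {s : ℕ} (hs : s ∈ S) (h0 : s ≠ 0) :
    ∃ p ∈ S.primitives, ∃ r ∈ S, p + r = s := by
  induction s using Nat.strong_induction_on with
  | _ s ih =>
    by_cases hp : s ∈ S.primitives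
    · exact ⟨s, hp, 0, S.zero_mem, rfl⟩
    have : ∃ x ∈ S.star, ∃ y ∈ S.star, x + y = s := by
      by_contra hc
      exact hp ⟨⟨hs, h0⟩, hc⟩
    obtain ⟨x, hx, y, hy, rfl⟩ := this
    have hy0 := hy.2
    obtain ⟨p, hpp, r, hr, rfl⟩ := ih x (by omega) hx.1 hx.2
    exact ⟨p, hpp, r + y, S.add_mem hr hy.1, by ring⟩

theorem exists_eq_add_of_primitives (S : NumericalSemigroup) {x : ℕ}
    (hP : ∀ p ∈ S.primitives, p = S.multiplicity ∨ p = x) {s : ℕ} (hs : s ∈ S) :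
    ∃ a b : ℕ, s = a * S.multiplicity + b * x := by
  induction s using Nat.strong_induction_on with
  | _ s ih =>
    by_cases h0 : s = 0
    · exact ⟨0, 0, by simpa using h0⟩
    obtain ⟨p, hp, r, hr, rfl⟩ := S.exists_primitive_add hs h0
    have := hp.1.2
    obtain ⟨a, b, rfl⟩ := ih r (by omega) hr
    rcases hP p hp with rfl | rfl
    · exact ⟨a + 1, b, by ring⟩
    · exact ⟨a, b + 1, by ring⟩

/-- A numerical semigroup generated by its multiplicity and one more element is symmetric. -/
theorem exists_frobenius_eq_add (S : NumericalSemigroup) {x : ℕ} (hx : x ∈ S)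
    (hP : ∀ p ∈ S.primitives, p = S.multiplicity ∨ p = x) {h : ℕ} (hh : h ∉ S) :
    ∃ s ∈ S, (h : ℤ) + s = S.frobenius := by
  have hm := S.multiplicity_pos
  have hF := S.le_frobenius_of_not_mem hh
  obtain ⟨f, hf⟩ := Int.eq_ofNat_of_zero_le (by omega : 0 ≤ S.frobenius)
  have hfS : f ∉ S := fun hc => S.frobenius_ne hc hf.symm
  -- Climb from the gap g in steps of m until S is first reached. A generator expression of the
  -- element reached cannot involve m, since removing one copy would place the previous step in S.
  have repr : ∀ g : ℕ, g ∉ S → ∀ n, g + n * S.multiplicity ∈ S →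
      ∃ j b, g + j * S.multiplicity ∉ S ∧ g + (j + 1) * S.multiplicity = b * x := by
    intro g hg n hn
    classical
    have hex : ∃ n, g + n * S.multiplicity ∈ S := ⟨n, hn⟩
    have hpos : Nat.find hex ≠ 0 := by
      intro e
      have := Nat.find_spec hex
      rw [e] at this
      exact hg (by simpa using this)
    obtain ⟨j, hj⟩ := Nat.exists_eq_succ_of_ne_zero hpos
    have hjn : g + j * S.multiplicity ∉ S := Nat.find_min hex (by omega)
    have hjs := Nat.find_spec hex
    rw [hj] at hjs
    obtain ⟨a, b, e⟩ := S.exists_eq_add_of_primitives hP hjs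
    refine ⟨j, b, hjn, ?_⟩
    rcases Nat.eq_zero_or_pos a with rfl | ha
    · simpa using e
    · exfalso
      obtain ⟨a, rfl⟩ := Nat.exists_eq_succ_of_ne_zero ha.ne'
      refine hjn ?_
      have : g + j * S.multiplicity = a * S.multiplicity + b * x := by
        rw [Nat.succ_mul, Nat.succ_mul] at e
        omega
      rw [this]
      exact S.add_mem (S.nat_mul_mem a S.multiplicity_mem) (S.nat_mul_mem b hx)
  obtain ⟨j, b, hj, e⟩ := repr h hh (f + 1) (S.mem_of_frobenius_lt (by
    rw [hf]
    have : f + 1 ≤ (f + 1) * S.multiplicity := Nat.le_mul_of_pos_right _ hm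
    have h2 : ((f + 1 : ℕ) : ℤ) ≤ ((f + 1) * S.multiplicity : ℕ) := by exact_mod_cast this
    rw [Nat.cast_add (m := h)]
    omega))
  obtain ⟨i, k, hi, e'⟩ := repr f hfS 1 (S.mem_of_frobenius_lt (by
    rw [hf]
    push_cast
    omega))
  -- No gap exceeds F, so already F + m is a multiple kx. Subtracting h + (j + 1)m = bx gives F - h
  -- = (k - b)x + jm.
  have hi0 : i = 0 := by
    have := S.le_frobenius_of_not_mem hi
    rw [hf] at this
    have : i * S.multiplicity = 0 := by
      push_cast at this
      zify
      have : (0 : ℤ) ≤ i * S.multiplicity := by positivity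
      omega
    rcases Nat.mul_eq_zero.1 this with h0 | h0 <;> omega
  subst hi0
  have hle := S.le_frobenius_of_not_mem hj
  rw [hf] at hle
  have hle' : h + j * S.multiplicity ≤ f := by exact_mod_cast hle
  have hbk : b * x ≤ k * x := by
    rw [← e, ← e', add_mul]
    omega
  refine ⟨(k - b) * x + j * S.multiplicity,
    S.add_mem (S.nat_mul_mem _ hx) (S.nat_mul_mem _ S.multiplicity_mem), ?_⟩
  rw [hf, Nat.sub_mul]
  rw [add_mul] at e
  have : h + (k * x - b * x + j * S.multiplicity) = f := by omega
  exact_mod_cast this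

/-- By symmetry a ↦ F - a injects the gaps into the left part, and together these two sets cover [0,
c). -/
theorem natConductor_le_two_mul (S : NumericalSemigroup) {x : ℕ} (hx : x ∈ S)
    (hP : ∀ p ∈ S.primitives, p = S.multiplicity ∨ p = x) :
    S.natConductor ≤ 2 * S.leftPart.ncard := by
  have hF := S.natConductor_eq
  have hcover : (Finset.range S.natConductor : Set ℕ) ⊆ (S : Set ℕ)ᶜ ∪ S.leftPart := by
    intro a ha
    simp only [Finset.coe_range, Set.mem_Iio] at ha
    by_cases haS : a ∈ S
    · have := S.frobenius_ne haS
      exact Or.inr ⟨haS, by omega⟩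
    · exact Or.inl haS
  have h1 := Set.ncard_le_ncard hcover (S.finite_compl.union S.finite_leftPart)
  rw [Set.ncard_coe_finset, Finset.card_range] at h1
  have h2 := Set.ncard_union_le (S : Set ℕ)ᶜ S.leftPart
  have h3 : ((S : Set ℕ)ᶜ).ncard ≤ S.leftPart.ncard := by
    refine Set.ncard_le_ncard_of_injOn (fun a => (S.frobenius - a).toNat) ?_ ?_ S.finite_leftPart
    · intro a ha
      obtain ⟨s, hs, e⟩ := S.exists_frobenius_eq_add hx hP ha
      have ha0 : a ≠ 0 := by
        rintro rfl
        exact ha S.zero_mem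
      have : (S.frobenius - a).toNat = s := by omega
      simp only [this]
      exact ⟨hs, by omega⟩
    · intro a ha b hb e
      have := S.le_frobenius_of_not_mem ha
      have := S.le_frobenius_of_not_mem hb
      simp only at e
      omega
  omega

theorem satisfiesWilf_of_le_two (S : NumericalSemigroup) (h2 : S.embeddingDimension ≤ 2) :
    S.SatisfiesWilf := by
  unfold SatisfiesWilf
  have hF := S.natConductor_eq
  have he := S.embeddingDimension_eq
  have mem_prims' : ∀ {p}, p ∈ S.primitives → p = S.multiplicity ∨ p ∈ prims S.apery := by
    intro p hp
    rw [primitives_eq] at hp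
    exact hp
  suffices S.natConductor ≤ S.embeddingDimension * S.leftPart.ncard by
    unfold conductor
    rw [← hF, ge_iff_le]
    exact_mod_cast this
  rcases Nat.eq_zero_or_pos (prims S.apery).card with h0 | h1
  · have hemp := Finset.card_eq_zero.1 h0
    have hP : ∀ p ∈ S.primitives, p = S.multiplicity ∨ p = S.multiplicity := by
      intro p hp
      simpa [hemp] using mem_prims' hp
    have hap : S.apery = ∅ := by
      rw [Finset.eq_empty_iff_forall_notMem]
      intro w hw
      obtain ⟨hw1, hw2, hw3⟩ := S.mem_apery.1 hw
      obtain ⟨p, hp, r, hr, e⟩ := S.exists_primitive_add hw1 hw2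
      rcases hP p hp with rfl | rfl <;> exact hw3 r hr (by omega)
    have hm := S.card_apery
    rw [hap, Finset.card_empty, zero_add] at hm
    have hall : ∀ a, a ∈ S := fun a => by
      have := S.nat_mul_mem a S.multiplicity_mem
      rwa [← hm, mul_one] at this
    have : S.natConductor = 0 := by
      by_contra hc
      exact S.frobenius_ne (hall (S.natConductor - 1)) (by omega)
    omega
  · obtain ⟨x, hx⟩ := Finset.card_eq_one.1 (by omega : (prims S.apery).card = 1)
    have hxS : x ∈ S := (S.mem_apery.1 (prims_subset _ (by rw [hx]; simp))).1
    have := S.natConductor_le_two_mul hxS fun p hp => by simpa [hx] using mem_prims' hp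
    rw [he, hx]
    simpa using this

/-- Eliahou's theorem: Wilf's conjecture holds if the embedding dimension is at least a third of
the multiplicity. -/
theorem satisfiesWilf_of_multiplicity_le (S : NumericalSemigroup)
    (h : S.multiplicity ≤ 3 * S.embeddingDimension) : S.SatisfiesWilf := by
  rcases Nat.lt_or_ge S.embeddingDimension 3 with h3 | h3
  · exact S.satisfiesWilf_of_le_two (by omega)
  · exact S.satisfiesWilf_of_three_le h3 h

/-! ### Children and descendants -/

section Child

variable {S T : NumericalSemigroup} {a : ℕ}

theorem mem_of_coe_eq_diff (hT : (T : Set ℕ) = (S : Set ℕ) \ {a}) {b : ℕ} :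
    b ∈ T ↔ b ∈ S ∧ b ≠ a := by
  have : b ∈ (T : Set ℕ) ↔ b ∈ (S : Set ℕ) \ {a} := by rw [hT]
  simpa using this

theorem genus_of_coe_eq_diff (hT : (T : Set ℕ) = (S : Set ℕ) \ {a}) (ha : a ∈ S) :
    T.genus = S.genus + 1 := by
  unfold genus
  have : (T : Set ℕ)ᶜ = insert a (S : Set ℕ)ᶜ := by
    ext b
    have := mem_of_coe_eq_diff hT (b := b)
    simp only [Set.mem_compl_iff, SetLike.mem_coe, this, Set.mem_insert_iff]
    tauto
  rw [this, Set.ncard_insert_of_notMem (by simpa using ha) S.finite_compl]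

theorem primitives_diff_subset (hT : (T : Set ℕ) = (S : Set ℕ) \ {a}) :
    S.primitives \ {a} ⊆ T.primitives := by
  rintro p ⟨⟨⟨hp, hp0⟩, hpd⟩, hpa⟩
  refine ⟨⟨(mem_of_coe_eq_diff hT).2 ⟨hp, hpa⟩, hp0⟩, ?_⟩
  rintro ⟨x, hx, y, hy, e⟩
  exact hpd ⟨x, ⟨((mem_of_coe_eq_diff hT).1 hx.1).1, hx.2⟩, y,
    ⟨((mem_of_coe_eq_diff hT).1 hy.1).1, hy.2⟩, e⟩

theorem embeddingDimension_le_of_coe_eq_diff (hT : (T : Set ℕ) = (S : Set ℕ) \ {a})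
    (ha : a ∈ S.primitives) : S.embeddingDimension ≤ T.embeddingDimension + 1 := by
  have h1 := Set.ncard_le_ncard (primitives_diff_subset hT) T.finite_primitives
  have h2 := Set.ncard_sdiff_singleton_add_one ha S.finite_primitives
  unfold embeddingDimension
  omega

/-- Passing to a child raises the genus by one and decreases `3 e - m` by at most three. -/
theorem IsChild.bound (h : T.IsChild S) : T.genus = S.genus + 1 ∧
    3 * S.embeddingDimension + T.multiplicity
      ≤ 3 * T.embeddingDimension + S.multiplicity + 3 := by
  obtain ⟨a, ⟨haP, haR⟩, hT⟩ := h
  refine ⟨genus_of_coe_eq_diff hT haP.1.1, ?_⟩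
  have he := embeddingDimension_le_of_coe_eq_diff hT haP
  have hm := S.multiplicity_pos
  by_cases ham : a = S.multiplicity
  -- Since m > F, here S consists of 0 and all integers from m on. The multiplicity may rise by one,
  -- so e must not drop: 2m + 1 = m + (m + 1) becomes primitive once m is removed.
  · subst ham
    have hgt : ∀ b, S.multiplicity < b → b ∈ T := fun b hb =>
      (mem_of_coe_eq_diff hT).2 ⟨S.mem_of_frobenius_lt (by have := haR.2; omega), by omega⟩
    have hmT := T.multiplicity_le (hgt (S.multiplicity + 1) (by omega)) (by omega)
    have hlt : ∀ b ∈ T.star, S.multiplicity < b := by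
      rintro b ⟨hb, hb0⟩
      obtain ⟨h1, h2⟩ := (mem_of_coe_eq_diff hT).1 hb
      have := S.multiplicity_le h1 hb0
      omega
    have hnew : 2 * S.multiplicity + 1 ∈ T.primitives := by
      refine ⟨⟨hgt _ (by omega), by omega⟩, ?_⟩
      rintro ⟨x, hx, y, hy, e⟩
      have := hlt x hx
      have := hlt y hy
      omega
    have hnot : 2 * S.multiplicity + 1 ∉ S.primitives \ {S.multiplicity} := by
      rintro ⟨⟨-, hd⟩, -⟩
      exact hd ⟨S.multiplicity, S.isLeast_multiplicity.1, S.multiplicity + 1,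
        ⟨((mem_of_coe_eq_diff hT).1 (hgt _ (by omega))).1, by omega⟩, by ring⟩
    have h1 := Set.ncard_le_ncard
      (Set.insert_subset hnew (primitives_diff_subset hT)) T.finite_primitives
    rw [Set.ncard_insert_of_notMem hnot (S.finite_primitives.subset Set.sdiff_subset)] at h1
    have h2 := Set.ncard_sdiff_singleton_add_one haP S.finite_primitives
    unfold embeddingDimension
    omega
  · have := T.multiplicity_le
      ((mem_of_coe_eq_diff hT).2 ⟨S.multiplicity_mem, Ne.symm ham⟩) hm.ne'
    omega

end Child

/-- Each passage adds 3 to 3g, which is the most that 3e - m can lose. -/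
theorem IsDescendant.bound {S T : NumericalSemigroup} (h : T.IsDescendant S) :
    3 * S.embeddingDimension + 3 * S.genus + T.multiplicity
      ≤ 3 * T.embeddingDimension + 3 * T.genus + S.multiplicity := by
  induction h with
  | refl => omega
  | tail _ hc ih =>
    have := IsChild.bound hc
    omega

end NumericalSemigroup

theorem mainTheorem5 (G : ℕ) (hG : 1 ≤ G) (S : NumericalSemigroup) (hg : S.genus ≤ G)
    (he : (S.embeddingDimension : ℚ) ≥ (S.multiplicity : ℚ) / 3 + ((G : ℚ) - (S.genus : ℚ))) :
    ∀ T : NumericalSemigroup, T.IsDescendant S → T.genus ≤ G → T.SatisfiesWilf := by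
  intro T hT hTG
  have h1 := NumericalSemigroup.IsDescendant.bound hT
  have h2 : S.multiplicity + 3 * G ≤ 3 * S.embeddingDimension + 3 * S.genus := by
    have : (S.multiplicity : ℚ) + 3 * G ≤ 3 * S.embeddingDimension + 3 * S.genus := by linarith
    exact_mod_cast this
  exact T.satisfiesWilf_of_multiplicity_le (by omega)
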